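/- Let $k$ be an algebraically closed field, $\Gamma=(\Gamma_0,\Gamma_1,s,e)$ a finite acyclic quiver, and $\mathcal A=(A_i)_{i\in\Gamma_0}$ a family of finite-dimensional basic $k$-algebras, each with a fixed presentation $A_i\cong k\Sigma_i/\Omega_i$, where $\Sigma_i$ is a finite quiver and $\Omega_i$ an admissible ideal. Write $\overline{\gamma}\in A_i$ for the class of a path $\gamma$ of $\Sigma_i$. Let $I$ be a set of relations over $\Gamma$ (each a $k$-linear combination of paths with common start and common end) generating an admissible ideal of $k\Gamma$. An $\mathcal A$-path is a sequence $a_1\beta_1a_2\cdots a_n\beta_na_{n+1}$ ($n\ge 0$), where $\beta_1\cdots\beta_n$ is a path of $\Gamma$ and each $a_r$ is an element of the algebra at the vertex where it stands. The generalized path algebra $k(\Gamma,\mathcal A)$ is the span of the $\mathcal A$-paths modulo multilinearity in the entries $a_r$, with $(a_1\beta_1\cdots\beta_na_{n+1})(b_1\gamma_1\cdots\gamma_mb_{m+1})=a_1\beta_1\cdots\beta_n(a_{n+1}b_1)\gamma_1\cdots\gamma_mb_{m+1}$ if the first path ends where the second begins, and $0$ otherwise. Let $\Lambda=k(\Gamma,\mathcal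 A,I)$ be its quotient by the two-sided ideal generated by all elements $\sum_r\lambda_r\,\beta_{r1}\overline{\gamma_{r1}}\beta_{r2}\cdots\overline{\gamma_{r(m_r-1)}}\beta_{rm_r}$ with $\sum_r\lambda_r\,\beta_{r1}\cdots\beta_{rm_r}\in I$ and $\gamma_{rt}$ any path of the quiver $\Sigma_{e(\beta_{rt})}$. Modules are right modules. A representation of $\Lambda$ consists of $A_l$-modules $M_l$ $(l\in\Gamma_0)$ and $k$-linear maps $\phi_\alpha:M_{s(\alpha)}\to M_{e(\alpha)}$ $(\alpha\in\Gamma_1)$ such that for all such $\lambda_r,\beta_{rt},\gamma_{rt}$ one has $\sum_r\lambda_r\,\phi_{\beta_{rm_r}}\circ\overline{\gamma_{r(m_r-1)}}\circ\cdots\circ\overline{\gamma_{r1}}\circ\phi_{\beta_{r1}}=0$, where an element of an algebra denotes right multiplication by it. The representation of a $\Lambda$-module $X$ is given by $M_l=X\cdot 1_l$, where $1_l$ is the identity of $A_l$, and $\phi_\alpha(x)=x\alpha$. The radical $\operatorname{rad}X$ of a module $X$ is the intersection of its maximal submodules. For each $i$ let $e_{i1},\dots,e_{is_i}$ be a complete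 set of pairwise orthogonal primitive idempotents of $A_i$, and let $P_i^j=e_{ij}A_i$ and $P(i,j)=\overline{e_{ij}}\Lambda$, where $\overline{a}$ is the class in $\Lambda$ of $a\in A_i$. **Proposition.** Let $i\in\Gamma_0$, $1\le j\le s_i$, and let $((M_l)_{l\in\Gamma_0},(\phi_\alpha)_{\alpha\in\Gamma_1})$ be the representation of $P(i,j)$. Then $x\mapsto\overline{x}$ is an isomorphism of $A_i$-modules $P_i^j\to M_i$. Identify $P_i^j$ with $M_i$ through it, and put $N_i=\operatorname{rad}P_i^j$ and $N_l=M_l$ for $l\ne i$. Then $\phi_\alpha(N_{s(\alpha)})\subseteq N_{e(\alpha)}$ for every $\alpha\in\Gamma_1$, and the representation of $\operatorname{rad}P(i,j)$ is $((N_l)_{l\in\Gamma_0},(\psi_\alpha)_{\alpha\in\Gamma_1})$, where $\psi_\alpha$ is the restriction of $\phi_\alpha$ to $N_{s(\alpha)}$; more precisely, there is an isomorphism between these two representations whose composite with the inclusion of $((N_l),(\psi_\alpha))$ into $((M_l),(\phi_\alpha))$ is the morphism induced by the inclusion $\operatorname{rad}P(i,j)\subseteq P(i,j)$. -/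

import Mathlib

universe uk uΓ va vv us vs w w'

noncomputable section

open MulOpposite

/-! ## The algebra of a finite family of composable Hom-spaces

For a finite set `V` and `k`-vector spaces `H i j` (`i j : V`) with an associative unital `k`-bilinear
composition `H i j × H j l → H i l`, the space `⨁ i j, H i j` is a unital algebra; elements of
`H i j` and `H j' l` with `j ≠ j'` multiply to zero and the identity is the sum of the local ones. -/

/-- An associative, unital, `k`-bilinear composition on a family of `k`-vector spaces. -/
class LinComp (k : Type*) [Field k] {V : Type*} (H : V → V → Type*)
    [∀ i j, AddCommGroup (H i j)] [∀ i j, Module k (H i j)] where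
  comp : ∀ {i j l : V}, H i j →ₗ[k] H j l →ₗ[k] H i l
  idn : ∀ i : V, H i i
  comp_assoc : ∀ {i j l m : V} (f : H i j) (g : H j l) (h : H l m),
    comp (comp f g) h = comp f (comp g h)
  idn_comp : ∀ {i j : V} (f : H i j), comp (idn i) f = f
  comp_idn : ∀ {i j : V} (f : H i j), comp f (idn j) = f

/-- The direct sum `⨁ i j, H i j` over the finite set `V × V`. -/
def CompAlg (k : Type*) {V : Type*} (H : V → V → Type*) : Type _ :=
  let _ := k
  ∀ i j, H i j

namespace CompAlg

variable {k : Type*} [Field k] {V : Type*} {H : V → V → Type*}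
  [∀ i j, AddCommGroup (H i j)] [∀ i j, Module k (H i j)]

instance : AddCommGroup (CompAlg k H) := inferInstanceAs (AddCommGroup (∀ i j, H i j))

instance : Module k (CompAlg k H) := inferInstanceAs (Module k (∀ i j, H i j))

@[ext] theorem ext {f g : CompAlg k H} (h : ∀ i j, f i j = g i j) : f = g :=
  funext fun i => funext fun j => h i j

theorem add_apply (f g : CompAlg k H) (i j : V) : (f + g) i j = f i j + g i j := rfl

theorem smul_apply (c : k) (f : CompAlg k H) (i j : V) : (c • f) i j = c • f i j := rfl

theorem zero_apply (i j : V) : (0 : CompAlg k H) i j = 0 := rfl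

open Classical in
/-- The inclusion of the component `H i j`. -/
def of (k : Type*) {V : Type*} {H : V → V → Type*} [Field k] [∀ i j, AddCommGroup (H i j)]
    [∀ i j, Module k (H i j)] (i j : V) : H i j →ₗ[k] CompAlg k H :=
  (LinearMap.single k (fun i => ∀ j, H i j) i).comp (LinearMap.single k (fun j => H i j) j)

theorem of_same (i j : V) (f : H i j) : of k i j f i j = f := by
  classical
  change Pi.single (M := fun i => ∀ j, H i j) i (Pi.single (M := fun j => H i j) j f) i j = f
  simp

theorem of_ne_left {i j a b : V} (f : H i j) (h : a ≠ i) : of k i j f a b = 0 := by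
  classical
  change Pi.single (M := fun i => ∀ j, H i j) i (Pi.single (M := fun j => H i j) j f) a b = 0
  rw [Pi.single_eq_of_ne h]
  rfl

theorem of_ne_right {i j b : V} (f : H i j) (h : b ≠ j) : of k i j f i b = 0 := by
  classical
  change Pi.single (M := fun i => ∀ j, H i j) i (Pi.single (M := fun j => H i j) j f) i b = 0
  rw [Pi.single_eq_same, Pi.single_eq_of_ne h]

variable [Fintype V] [LinComp k H]

instance : Mul (CompAlg k H) :=
  ⟨fun f g i l => ∑ j, LinComp.comp (k := k) (H := H) (f i j) (g j l)⟩

open Classical in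
instance : One (CompAlg k H) :=
  ⟨fun i => Pi.single i (LinComp.idn (k := k) (H := H) i)⟩

theorem mul_apply (f g : CompAlg k H) (i l : V) :
    (f * g) i l = ∑ j, LinComp.comp (k := k) (H := H) (f i j) (g j l) := rfl

open Classical in
theorem one_apply (i j : V) :
    (1 : CompAlg k H) i j =
      Pi.single (M := fun j => H i j) i (LinComp.idn (k := k) (H := H) i) j := rfl

instance : Ring (CompAlg k H) :=
  { (inferInstance : AddCommGroup (CompAlg k H)),
    (inferInstance : Mul (CompAlg k H)), (inferInstance : One (CompAlg k H)) with
    left_distrib := fun f g h => by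
      ext i j; simp [mul_apply, add_apply, Finset.sum_add_distrib]
    right_distrib := fun f g h => by
      ext i j; simp [mul_apply, add_apply, Finset.sum_add_distrib]
    zero_mul := fun f => by ext i j; simp [mul_apply, zero_apply]
    mul_zero := fun f => by ext i j; simp [mul_apply, zero_apply]
    mul_assoc := fun f g h => by
      ext i l
      simp only [mul_apply, map_sum, LinearMap.sum_apply, LinComp.comp_assoc]
      rw [Finset.sum_comm]
    one_mul := fun f => by
      classical
      ext i j
      rw [mul_apply, Finset.sum_eq_single i]
      · rw [one_apply, Pi.single_eq_same, LinComp.idn_comp]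
      · intro b _ hb
        rw [one_apply, Pi.single_eq_of_ne hb, map_zero, LinearMap.zero_apply]
      · simp
    mul_one := fun f => by
      classical
      ext i j
      rw [mul_apply, Finset.sum_eq_single j]
      · rw [one_apply, Pi.single_eq_same, LinComp.comp_idn]
      · intro b _ hb
        rw [one_apply, Pi.single_eq_of_ne hb.symm, map_zero]
      · simp }

instance : Algebra k (CompAlg k H) :=
  Algebra.ofModule
    (fun c f g => by ext i j; simp [mul_apply, smul_apply, Finset.smul_sum])
    (fun c f g => by ext i j; simp [mul_apply, smul_apply, Finset.smul_sum])

theorem of_mul_of {i j l : V} (f : H i j) (g : H j l) :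
    of k i j f * of k j l g = of k i l (LinComp.comp (k := k) (H := H) f g) := by
  ext a b
  rw [mul_apply]
  by_cases ha : a = i
  · subst ha
    rw [Finset.sum_eq_single j]
    · rw [of_same]
      by_cases hb : b = l
      · subst hb; rw [of_same, of_same]
      · rw [of_ne_right _ hb, of_ne_right _ hb, map_zero]
    · intro c _ hc
      rw [of_ne_right _ hc, map_zero, LinearMap.zero_apply]
    · simp
  · rw [of_ne_left _ ha]
    refine Finset.sum_eq_zero fun c _ => ?_
    rw [of_ne_left _ ha, map_zero, LinearMap.zero_apply]

end CompAlg

/-! ## Path algebras and admissible ideals -/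

/-- The vector space with basis the paths from `i` to `j`. -/
abbrev PathHom (k : Type*) [Field k] (Q : Type*) [Quiver Q] (i j : Q) : Type _ :=
  Quiver.Path i j →₀ k

/-- Composition of linear combinations of paths, extending concatenation bilinearly. -/
def PathHom.comp (k : Type*) [Field k] {Q : Type*} [Quiver Q] {i j l : Q} :
    (Quiver.Path i j →₀ k) →ₗ[k] (Quiver.Path j l →₀ k) →ₗ[k] (Quiver.Path i l →₀ k) :=
  Finsupp.linearCombination k fun p : Quiver.Path i j =>
    Finsupp.lmapDomain k k fun q : Quiver.Path j l => p.comp q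

theorem PathHom.comp_single (k : Type*) [Field k] {Q : Type*} [Quiver Q] {i j l : Q}
    (p : Quiver.Path i j) (q : Quiver.Path j l) (a b : k) :
    PathHom.comp k (Finsupp.single p a) (Finsupp.single q b) =
      Finsupp.single (p.comp q) (a * b) := by
  simp [PathHom.comp]

instance (k : Type*) [Field k] (Q : Type*) [Quiver Q] : LinComp k (PathHom k Q) where
  comp := PathHom.comp k
  idn i := Finsupp.single Quiver.Path.nil 1
  comp_assoc {i j l m} f g h := by
    change PathHom.comp k (PathHom.comp k f g) h = PathHom.comp k f (PathHom.comp k g h)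
    change Quiver.Path i j →₀ k at f
    change Quiver.Path j l →₀ k at g
    change Quiver.Path l m →₀ k at h
    induction f using Finsupp.induction_linear with
    | zero => simp
    | add f₁ f₂ h₁ h₂ => simp only [map_add, LinearMap.add_apply, h₁, h₂]
    | single p a =>
      induction g using Finsupp.induction_linear with
      | zero => simp
      | add f₁ f₂ h₁ h₂ => simp only [map_add, LinearMap.add_apply, h₁, h₂]
      | single q b =>
        induction h using Finsupp.induction_linear with
        | zero => simp
        | add f₁ f₂ h₁ h₂ => simp only [map_add, h₁, h₂]
        | single r c => simp only [PathHom.comp_single, Quiver.Path.comp_assoc, mul_assoc]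
  idn_comp {i j} f := by
    change PathHom.comp k _ f = f
    change Quiver.Path i j →₀ k at f
    induction f using Finsupp.induction_linear with
    | zero => simp
    | add f₁ f₂ h₁ h₂ => simp only [map_add, h₁, h₂]
    | single p a => simp only [PathHom.comp_single, Quiver.Path.nil_comp, one_mul]
  comp_idn {i j} f := by
    change PathHom.comp k f _ = f
    change Quiver.Path i j →₀ k at f
    induction f using Finsupp.induction_linear with
    | zero => simp
    | add f₁ f₂ h₁ h₂ => simp only [map_add, LinearMap.add_apply, h₁, h₂]
    | single p a => simp only [PathHom.comp_single, Quiver.Path.comp_nil, mul_one]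

/-- The path algebra `kQ` of a quiver `Q` with finitely many vertices. -/
abbrev PathAlgebra (k : Type*) [Field k] (Q : Type*) [Quiver Q] : Type _ :=
  CompAlg k (PathHom k Q)

/-- The path `p` as an element of `kQ`. -/
def PathAlgebra.ofPath (k : Type*) [Field k] {Q : Type*} [Quiver Q] {i j : Q}
    (p : Quiver.Path i j) : PathAlgebra k Q :=
  CompAlg.of k (H := PathHom k Q) i j (Finsupp.single p (1 : k) : Quiver.Path i j →₀ k)

/-- The ideal `Rⁿ` of `kQ`, where `R` is the arrow ideal: the ideal generated by the paths of
length at least `n`. -/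
def PathAlgebra.lengthIdeal (k : Type*) [Field k] (Q : Type*) [Quiver Q] [Fintype Q] (n : ℕ) :
    TwoSidedIdeal (PathAlgebra k Q) :=
  TwoSidedIdeal.span
    {x | ∃ (i j : Q) (p : Quiver.Path i j), n ≤ p.length ∧ x = PathAlgebra.ofPath k p}

/-- Admissible ideals: `Rᵐ ⊆ J ⊆ R²` for some `m ≥ 2`. -/
def PathAlgebra.IsAdmissible {k : Type*} [Field k] {Q : Type*} [Quiver Q] [Fintype Q]
    (J : TwoSidedIdeal (PathAlgebra k Q)) : Prop :=
  J ≤ PathAlgebra.lengthIdeal k Q 2 ∧ ∃ m, 2 ≤ m ∧ PathAlgebra.lengthIdeal k Q m ≤ J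

/-- A presentation `B ≅ kΣ/Ω` with `Σ` a finite quiver and `Ω` an admissible ideal, given as the
surjection `kΣ → B` with kernel `Ω`. -/
structure QuiverPresentation (k : Type uk) [Field k] (B : Type va) [Ring B] [Algebra k B] where
  vertex : Type us
  [quiver : Quiver.{vs} vertex]
  [fintype : Fintype vertex]
  finite_arrows : ∀ u v : vertex, Finite (u ⟶ v)
  proj : PathAlgebra k vertex →ₐ[k] B
  surjective : Function.Surjective proj
  admissible : PathAlgebra.IsAdmissible (TwoSidedIdeal.ker proj)

attribute [instance] QuiverPresentation.quiver QuiverPresentation.fintype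

/-- The class in `B` of a path of `Σ`. -/
def QuiverPresentation.bar {k : Type uk} [Field k] {B : Type va} [Ring B] [Algebra k B]
    (π : QuiverPresentation.{uk, va, us, vs} k B) {u v : π.vertex} (σ : Quiver.Path u v) : B :=
  π.proj (PathAlgebra.ofPath k σ)

/-! ## Generalized path algebras -/

/-- `𝒜`-paths `a₁ β₁ a₂ ⋯ aₙ βₙ aₙ₊₁`, where `β₁ ⋯ βₙ` is a path and each `a` lies in the algebra of
the vertex at which it stands; `nil a` has length zero and `cons x β a` is `x β a`. -/
inductive APath {Γ : Type uΓ} [Quiver.{vv} Γ] (A : Γ → Type va) (i : Γ) :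
    Γ → Type (max uΓ vv va)
  | nil (a : A i) : APath A i i
  | cons {j l : Γ} (x : APath A i j) (β : j ⟶ l) (a : A l) : APath A i l

namespace APath

section

variable {Γ : Type uΓ} [Quiver.{vv} Γ] {A : Γ → Type va} [∀ i, Ring (A i)]

/-- Multiply the last entry by `b` on the right. -/
def mulLast {i : Γ} : ∀ {j : Γ}, APath A i j → A j → APath A i j
  | _, nil a, b => nil (a * b)
  | _, cons x β a, b => cons x β (a * b)

/-- `(a₁ β₁ ⋯ βₙ aₙ₊₁)(b₁ γ₁ ⋯ γₘ bₘ₊₁) = a₁ β₁ ⋯ βₙ (aₙ₊₁ b₁) γ₁ ⋯ γₘ bₘ₊₁`. -/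
def comp {i j : Γ} (x : APath A i j) : ∀ {l : Γ}, APath A j l → APath A i l
  | _, nil b => x.mulLast b
  | _, cons y β b => cons (x.comp y) β b

theorem mulLast_mulLast {i j : Γ} (x : APath A i j) (a b : A j) :
    (x.mulLast a).mulLast b = x.mulLast (a * b) := by
  cases x <;> simp [mulLast, mul_assoc]

theorem mulLast_one {i j : Γ} (x : APath A i j) : x.mulLast 1 = x := by
  cases x <;> simp [mulLast]

theorem comp_mulLast {i j l : Γ} (x : APath A i j) (y : APath A j l) (a : A l) :
    x.comp (y.mulLast a) = (x.comp y).mulLast a := by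
  cases y with
  | nil b => exact (mulLast_mulLast x b a).symm
  | cons y β b => rfl

theorem comp_assoc {i j l m : Γ} (x : APath A i j) (y : APath A j l) (z : APath A l m) :
    (x.comp y).comp z = x.comp (y.comp z) := by
  induction z with
  | nil c => simp [comp, comp_mulLast]
  | cons z β c ih => simp [comp, ih]

theorem comp_nil_one {i j : Γ} (x : APath A i j) : x.comp (nil 1) = x := by
  rw [comp, mulLast_one]

theorem nil_one_comp {i j : Γ} (x : APath A i j) : (nil 1 : APath A i i).comp x = x := by
  induction x with
  | nil c => simp [comp, mulLast]
  | cons x β c ih => simp [comp, ih]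

end

/-- `IsSlot f`: the map `f` inserts its argument, an element of `A v`, at one fixed position of an
`𝒜`-path all of whose other entries are fixed. -/
inductive IsSlot {Γ : Type uΓ} [Quiver.{vv} Γ] {A : Γ → Type va} :
    ∀ {v i j : Γ}, (A v → APath A i j) → Prop
  | nil {i : Γ} : IsSlot (fun a : A i => APath.nil a)
  | last {v i j : Γ} (x : APath A i j) (β : j ⟶ v) : IsSlot (fun a : A v => APath.cons x β a)
  | step {v i j l : Γ} {f : A v → APath A i j} (hf : IsSlot f) (β : j ⟶ l) (b : A l) :
      IsSlot (fun a => APath.cons (f a) β b)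

variable (k : Type uk) [Field k] {Γ : Type uΓ} [Quiver.{vv} Γ] (A : Γ → Type va)
  [∀ i, Ring (A i)] [∀ i, Algebra k (A i)]

/-- The subspace of the span of the `𝒜`-paths from `i` to `j` that is generated by the
multilinearity relations in the entries. -/
def multilinRel (i j : Γ) : Submodule k (APath A i j →₀ k) :=
  Submodule.span k
    ({z | ∃ (v : Γ) (f : A v → APath A i j) (a b : A v), IsSlot f ∧
        z = Finsupp.single (f (a + b)) 1 - (Finsupp.single (f a) 1 + Finsupp.single (f b) 1)} ∪
      {z | ∃ (v : Γ) (f : A v → APath A i j) (c : k) (a : A v), IsSlot f ∧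
        z = Finsupp.single (f (c • a)) 1 - c • Finsupp.single (f a) 1})

variable {A}

theorem IsSlot.mulLast {v : Γ} {i j : Γ} {f : A v → APath A i j} (hf : IsSlot f) (b : A j) :
    ∃ (g : A v → APath A i j) (c : A v →ₗ[k] A v), IsSlot g ∧
      ∀ a, (f a).mulLast b = g (c a) := by
  cases hf with
  | nil => exact ⟨_, LinearMap.mulRight k b, .nil, fun a => rfl⟩
  | last x β => exact ⟨_, LinearMap.mulRight k b, .last x β, fun a => rfl⟩
  | step hf β d => exact ⟨_, LinearMap.id, .step hf β (d * b), fun a => rfl⟩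

theorem IsSlot.comp_right {v : Γ} {i j l : Γ} {f : A v → APath A i j} (hf : IsSlot f)
    (y : APath A j l) :
    ∃ (g : A v → APath A i l) (c : A v →ₗ[k] A v), IsSlot g ∧
      ∀ a, (f a).comp y = g (c a) := by
  induction y with
  | nil b => exact hf.mulLast k b
  | cons y β b ih =>
    obtain ⟨g, c, hg, h⟩ := ih
    exact ⟨_, c, .step hg β b, fun a => by simp only [APath.comp, h]⟩

theorem IsSlot.comp_left {v : Γ} {i j l : Γ} {f : A v → APath A j l} (hf : IsSlot f)
    (x : APath A i j) :
    ∃ (g : A v → APath A i l) (c : A v →ₗ[k] A v), IsSlot g ∧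
      ∀ a, x.comp (f a) = g (c a) := by
  induction hf with
  | nil =>
    cases x with
    | nil d => exact ⟨_, LinearMap.mulLeft k d, .nil, fun a => rfl⟩
    | cons x β d => exact ⟨_, LinearMap.mulLeft k d, .last x β, fun a => rfl⟩
  | last y β => exact ⟨_, LinearMap.id, .last (x.comp y) β, fun a => rfl⟩
  | step hf β b ih =>
    obtain ⟨g, c, hg, h⟩ := ih x
    exact ⟨_, c, .step hg β b, fun a => by simp only [APath.comp, h]⟩

theorem multilinRel_le_comap {i j i' j' : Γ} (F : APath A i j → APath A i' j')
    (hF : ∀ (v : Γ) (f : A v → APath A i j), IsSlot f →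
      ∃ (g : A v → APath A i' j') (c : A v →ₗ[k] A v), IsSlot g ∧ ∀ a, F (f a) = g (c a)) :
    multilinRel k A i j ≤ (multilinRel k A i' j').comap (Finsupp.lmapDomain k k F) := by
  refine Submodule.span_le.2 ?_
  rintro z (⟨v, f, a, b, hf, rfl⟩ | ⟨v, f, c, a, hf, rfl⟩)
  · obtain ⟨g, d, hg, h⟩ := hF v f hf
    refine Submodule.subset_span (Or.inl ⟨v, g, d a, d b, hg, ?_⟩)
    simp only [map_sub, map_add, Finsupp.lmapDomain_apply, Finsupp.mapDomain_single, h]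
  · obtain ⟨g, d, hg, h⟩ := hF v f hf
    refine Submodule.subset_span (Or.inr ⟨v, g, c, d a, hg, ?_⟩)
    simp only [Finsupp.lmapDomain_apply, map_sub, Finsupp.mapDomain_single, h, map_smul]

end APath

section GPA

variable (k : Type uk) [Field k] {Γ : Type uΓ} [Quiver.{vv} Γ] (A : Γ → Type va)
  [∀ i, Ring (A i)] [∀ i, Algebra k (A i)]

/-- The part of `k(Γ,𝒜)` spanned by the `𝒜`-paths from `i` to `j`: the vector space with basis
these `𝒜`-paths, modulo the multilinearity relations. -/
abbrev GPathHom (i j : Γ) : Type _ := (APath A i j →₀ k) ⧸ APath.multilinRel k A i j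

variable {A}

/-- The class of an `𝒜`-path. -/
def GPathHom.mk {i j : Γ} (x : APath A i j) : GPathHom k A i j :=
  (APath.multilinRel k A i j).mkQ (Finsupp.single x 1)

theorem GPathHom.induction {i j : Γ} {motive : GPathHom k A i j → Prop}
    (zero : motive 0) (add : ∀ f g, motive f → motive g → motive (f + g))
    (smul_mk : ∀ (c : k) (x : APath A i j), motive (c • GPathHom.mk k x))
    (f : GPathHom k A i j) : motive f := by
  obtain ⟨f, rfl⟩ := (APath.multilinRel k A i j).mkQ_surjective f
  induction f using Finsupp.induction_linear with
  | zero => rw [map_zero]; exact zero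
  | add f g hf hg => rw [map_add]; exact add _ _ hf hg
  | single x c =>
    have := smul_mk c x
    rwa [GPathHom.mk, ← map_smul, Finsupp.smul_single, smul_eq_mul, mul_one] at this

/-- Composition with the class of `x` on the left. -/
def GPathHom.compLeft {i j : Γ} (l : Γ) (x : APath A i j) :
    GPathHom k A j l →ₗ[k] GPathHom k A i l :=
  Submodule.mapQ (APath.multilinRel k A j l) (APath.multilinRel k A i l)
    (Finsupp.lmapDomain k k fun y : APath A j l => x.comp y)
    (APath.multilinRel_le_comap k _ fun _ _ hf => hf.comp_left k x)

theorem GPathHom.compLeft_mk {i j l : Γ} (x : APath A i j) (y : APath A j l) :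
    GPathHom.compLeft k l x (GPathHom.mk k y) = GPathHom.mk k (x.comp y) := by
  simp [GPathHom.compLeft, GPathHom.mk, Finsupp.mapDomain_single]

theorem GPathHom.compLeft_linearCombination {i j l : Γ} (z : APath A i j →₀ k)
    (y : APath A j l) :
    Finsupp.linearCombination k (GPathHom.compLeft k l) z (GPathHom.mk k y) =
      (APath.multilinRel k A i l).mkQ
        (Finsupp.lmapDomain k k (fun x : APath A i j => x.comp y) z) := by
  induction z using Finsupp.induction_linear with
  | zero => simp only [map_zero, LinearMap.zero_apply]
  | add f g hf hg => simp only [map_add, LinearMap.add_apply, hf, hg]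
  | single x a =>
    rw [Finsupp.linearCombination_single, LinearMap.smul_apply, GPathHom.compLeft_mk,
      Finsupp.lmapDomain_apply, Finsupp.mapDomain_single, GPathHom.mk, ← map_smul,
      Finsupp.smul_single, smul_eq_mul, mul_one]

/-- The composition of classes of `𝒜`-paths, extended bilinearly. -/
def GPathHom.comp {i j l : Γ} :
    GPathHom k A i j →ₗ[k] GPathHom k A j l →ₗ[k] GPathHom k A i l :=
  Submodule.liftQ (APath.multilinRel k A i j)
    (Finsupp.linearCombination k (GPathHom.compLeft k l))
    (by
      intro z hz
      rw [LinearMap.mem_ker]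
      refine LinearMap.ext fun g => ?_
      rw [LinearMap.zero_apply]
      induction g using GPathHom.induction k with
      | zero => rw [map_zero]
      | add f g hf hg => rw [map_add, hf, hg, add_zero]
      | smul_mk c y =>
        have h := APath.multilinRel_le_comap k (fun x : APath A i j => x.comp y)
            (fun _ _ hf => hf.comp_right k y) hz
        rw [map_smul, GPathHom.compLeft_linearCombination, Submodule.mkQ_apply,
          (Submodule.Quotient.mk_eq_zero _).2 (Submodule.mem_comap.1 h), smul_zero])

theorem GPathHom.comp_mk {i j l : Γ} (x : APath A i j) (y : APath A j l) :
    GPathHom.comp k (GPathHom.mk k x) (GPathHom.mk k y) = GPathHom.mk k (x.comp y) := by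
  rw [← GPathHom.compLeft_mk, GPathHom.comp, GPathHom.mk, Submodule.mkQ_apply,
    Submodule.liftQ_apply, Finsupp.linearCombination_single, one_smul]

variable (A) in
instance : LinComp k (GPathHom k A) where
  comp := GPathHom.comp k
  idn i := GPathHom.mk k (APath.nil 1)
  comp_assoc f g h := by
    induction f using GPathHom.induction k with
    | zero => simp
    | add f₁ f₂ h₁ h₂ => simp only [map_add, LinearMap.add_apply, h₁, h₂]
    | smul_mk a x =>
      induction g using GPathHom.induction k with
      | zero => simp
      | add f₁ f₂ h₁ h₂ => simp only [map_add, LinearMap.add_apply, h₁, h₂]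
      | smul_mk b y =>
        induction h using GPathHom.induction k with
        | zero => simp
        | add f₁ f₂ h₁ h₂ => simp only [map_add, h₁, h₂]
        | smul_mk c z =>
          simp only [map_smul, LinearMap.smul_apply, GPathHom.comp_mk, APath.comp_assoc]
  idn_comp f := by
    induction f using GPathHom.induction k with
    | zero => simp
    | add f₁ f₂ h₁ h₂ => simp only [map_add, h₁, h₂]
    | smul_mk a x => simp only [map_smul, GPathHom.comp_mk, APath.nil_one_comp]
  comp_idn f := by
    induction f using GPathHom.induction k with
    | zero => simp
    | add f₁ f₂ h₁ h₂ => simp only [map_add, LinearMap.add_apply, h₁, h₂]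
    | smul_mk a x =>
      simp only [map_smul, LinearMap.smul_apply, GPathHom.comp_mk, APath.comp_nil_one]

variable (A) in
/-- The generalized path algebra `k(Γ,𝒜)`. -/
def GPathAlgebra : Type _ := CompAlg k (GPathHom k A)

instance [Fintype Γ] : Ring (GPathAlgebra k A) := inferInstanceAs (Ring (CompAlg k (GPathHom k A)))

instance [Fintype Γ] : Algebra k (GPathAlgebra k A) :=
  inferInstanceAs (Algebra k (CompAlg k (GPathHom k A)))

/-- The inclusion of the part of `k(Γ,𝒜)` spanned by the `𝒜`-paths from `i` to `j`. -/
def GPathAlgebra.of [Fintype Γ] (i j : Γ) : GPathHom k A i j →ₗ[k] GPathAlgebra k A :=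
  CompAlg.of k (H := GPathHom k A) i j

/-- The class of an `𝒜`-path in `k(Γ,𝒜)`. -/
def GPathAlgebra.ofPath [Fintype Γ] {i j : Γ} (x : APath A i j) : GPathAlgebra k A :=
  GPathAlgebra.of k i j (GPathHom.mk k x)

theorem GPathAlgebra.of_mul_of [Fintype Γ] {i j l : Γ} (f : GPathHom k A i j)
    (g : GPathHom k A j l) :
    GPathAlgebra.of k i j f * GPathAlgebra.of k j l g =
      GPathAlgebra.of k i l (GPathHom.comp k f g) :=
  CompAlg.of_mul_of (k := k) (H := GPathHom k A) f g

theorem GPathAlgebra.ofPath_mul [Fintype Γ] {i j l : Γ} (x : APath A i j) (y : APath A j l) :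
    GPathAlgebra.ofPath k x * GPathAlgebra.ofPath k y = GPathAlgebra.ofPath k (x.comp y) := by
  unfold GPathAlgebra.ofPath
  rw [GPathAlgebra.of_mul_of, GPathHom.comp_mk]

theorem GPathHom.mk_slot_add {i j v : Γ} {f : A v → APath A i j} (hf : APath.IsSlot f)
    (a b : A v) : GPathHom.mk k (f (a + b)) = GPathHom.mk k (f a) + GPathHom.mk k (f b) := by
  unfold GPathHom.mk
  have h := (Submodule.Quotient.mk_eq_zero (APath.multilinRel k A i j)).2
    (Submodule.subset_span (Or.inl ⟨v, f, a, b, hf, rfl⟩))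
  rw [← Submodule.mkQ_apply, map_sub, map_add] at h
  exact sub_eq_zero.1 h

theorem GPathHom.mk_slot_smul {i j v : Γ} {f : A v → APath A i j} (hf : APath.IsSlot f)
    (c : k) (a : A v) : GPathHom.mk k (f (c • a)) = c • GPathHom.mk k (f a) := by
  unfold GPathHom.mk
  have h := (Submodule.Quotient.mk_eq_zero (APath.multilinRel k A i j)).2
    (Submodule.subset_span (Or.inr ⟨v, f, c, a, hf, rfl⟩))
  rw [← Submodule.mkQ_apply, map_sub, map_smul] at h
  exact sub_eq_zero.1 h

end GPA

/-! ## Generalized bound path algebras -/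

section GBP

variable {k : Type uk} [Field k] {Γ : Type uΓ} [Quiver.{vv} Γ] {A : Γ → Type va}
  [∀ i, Ring (A i)] [∀ i, Algebra k (A i)]

/-- `IsPreInsertion π p x`: for `p = β₁ ⋯ βₙ`, the `𝒜`-path `x` is `1 β₁ γ̄₁ β₂ γ̄₂ ⋯ βₙ γ̄ₙ` with paths
`γ_j` of the quiver presenting the algebra at the end of `β_j`. -/
inductive IsPreInsertion (π : ∀ i, QuiverPresentation.{uk, va, us, vs} k (A i)) :
    ∀ {i j : Γ}, Quiver.Path i j → APath A i j → Prop
  | nil {i : Γ} : IsPreInsertion π (Quiver.Path.nil : Quiver.Path i i) (APath.nil 1)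
  | cons {i j l : Γ} {p : Quiver.Path i j} {x : APath A i j} (h : IsPreInsertion π p x)
      (β : j ⟶ l) {u v : (π l).vertex} (σ : Quiver.Path u v) :
      IsPreInsertion π (p.cons β) (APath.cons x β ((π l).bar σ))

/-- `IsInsertion π p x`: for `p = β₁ ⋯ βₙ`, the `𝒜`-path `x` is `β₁ γ̄₁ β₂ γ̄₂ ⋯ γ̄ₙ₋₁ βₙ` (identities at
both ends) with paths `γ_j` of the quiver presenting the algebra at the end of `β_j`. -/
inductive IsInsertion (π : ∀ i, QuiverPresentation.{uk, va, us, vs} k (A i)) :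
    ∀ {i j : Γ}, Quiver.Path i j → APath A i j → Prop
  | nil {i : Γ} : IsInsertion π (Quiver.Path.nil : Quiver.Path i i) (APath.nil 1)
  | cons {i j l : Γ} {p : Quiver.Path i j} {x : APath A i j} (h : IsPreInsertion π p x)
      (β : j ⟶ l) : IsInsertion π (p.cons β) (APath.cons x β 1)

/-- A relation over `Γ`: a linear combination of paths with common start and common end. -/
abbrev QuiverRelation (k : Type uk) [Field k] (Γ : Type uΓ) [Quiver.{vv} Γ] : Type _ :=
  Σ i j : Γ, (Quiver.Path i j →₀ k)

/-- A relation as an element of `kΓ`. -/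
def QuiverRelation.toPathAlgebra (ρ : QuiverRelation k Γ) : PathAlgebra k Γ :=
  CompAlg.of k (H := PathHom k Γ) ρ.1 ρ.2.1 ρ.2.2

/-- The set `𝒜(I)`: in every relation of `I`, insert paths of the presenting quivers between
consecutive arrows, independently in every term of the relation. -/
def insertedRelations [Fintype Γ] (π : ∀ i, QuiverPresentation.{uk, va, us, vs} k (A i))
    (I : Set (QuiverRelation k Γ)) : Set (GPathAlgebra k A) :=
  {z | ∃ ρ ∈ I, ∃ x : Quiver.Path ρ.1 ρ.2.1 → APath A ρ.1 ρ.2.1,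
    (∀ p ∈ ρ.2.2.support, IsInsertion π p (x p)) ∧
      z = ρ.2.2.sum fun p c => c • GPathAlgebra.ofPath k (x p)}

variable [Fintype Γ]

/-- The generalized bound path algebra `Λ = k(Γ,𝒜,I) = k(Γ,𝒜)/(𝒜(I))`. -/
def GBPAlgebra (π : ∀ i, QuiverPresentation.{uk, va, us, vs} k (A i))
    (I : Set (QuiverRelation k Γ)) : Type _ :=
  (TwoSidedIdeal.span (insertedRelations π I)).ringCon.Quotient

namespace GBPAlgebra

variable (π : ∀ i, QuiverPresentation.{uk, va, us, vs} k (A i)) (I : Set (QuiverRelation k Γ))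

instance : Ring (GBPAlgebra π I) :=
  inferInstanceAs (Ring (TwoSidedIdeal.span (insertedRelations π I)).ringCon.Quotient)

instance : Algebra k (GBPAlgebra π I) :=
  inferInstanceAs (Algebra k (TwoSidedIdeal.span (insertedRelations π I)).ringCon.Quotient)

/-- The projection `k(Γ,𝒜) → Λ`. -/
def mk : GPathAlgebra k A →ₐ[k] GBPAlgebra π I :=
  { toFun := fun x => (x : (TwoSidedIdeal.span (insertedRelations π I)).ringCon.Quotient)
    map_one' := rfl
    map_mul' := fun _ _ => rfl
    map_zero' := rfl
    map_add' := fun _ _ => rfl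
    commutes' := fun _ => rfl }

theorem mk_surjective : Function.Surjective (mk π I) := fun x => Quotient.exists_rep x

theorem mk_eq_mk_iff (x y : GPathAlgebra k A) :
    mk π I x = mk π I y ↔ x - y ∈ TwoSidedIdeal.span (insertedRelations π I) :=
  (RingCon.eq (TwoSidedIdeal.span (insertedRelations π I)).ringCon).trans
    (TwoSidedIdeal.rel_iff _ _ _)

/-- The class of an `𝒜`-path in `Λ`. -/
def ofPath {i j : Γ} (x : APath A i j) : GBPAlgebra π I := mk π I (GPathAlgebra.ofPath k x)

/-- The class `ā` in `Λ` of an element `a` of `A_i`. -/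
def ofVertex (i : Γ) (a : A i) : GBPAlgebra π I := ofPath π I (APath.nil a)

/-- The class in `Λ` of an arrow. -/
def ofArrow {i j : Γ} (β : i ⟶ j) : GBPAlgebra π I :=
  ofPath π I (APath.cons (APath.nil 1) β 1)

theorem ofPath_mul {i j l : Γ} (x : APath A i j) (y : APath A j l) :
    ofPath π I x * ofPath π I y = ofPath π I (x.comp y) := by
  unfold ofPath
  rw [← map_mul, GPathAlgebra.ofPath_mul]

theorem ofVertex_mul (i : Γ) (a b : A i) :
    ofVertex π I i a * ofVertex π I i b = ofVertex π I i (a * b) :=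
  ofPath_mul π I _ _

theorem ofVertex_add (i : Γ) (a b : A i) :
    ofVertex π I i (a + b) = ofVertex π I i a + ofVertex π I i b := by
  unfold ofVertex ofPath GPathAlgebra.ofPath
  rw [GPathHom.mk_slot_add k APath.IsSlot.nil, map_add, map_add]

theorem ofVertex_smul (i : Γ) (c : k) (a : A i) :
    ofVertex π I i (c • a) = c • ofVertex π I i a := by
  unfold ofVertex ofPath GPathAlgebra.ofPath
  rw [GPathHom.mk_slot_smul k APath.IsSlot.nil, map_smul, map_smul]

theorem ofPath_cons {i j l : Γ} (x : APath A i j) (β : j ⟶ l) (a : A l) :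
    ofPath π I (APath.cons x β a) = ofPath π I x * ofArrow π I β * ofVertex π I l a := by
  unfold ofArrow ofVertex
  rw [ofPath_mul, ofPath_mul]
  congr 1
  cases x <;> simp [APath.comp, APath.mulLast]

theorem ofArrow_mul_ofVertex_one {i j : Γ} (β : i ⟶ j) :
    ofArrow π I β * ofVertex π I j 1 = ofArrow π I β := by
  unfold ofArrow ofVertex
  rw [ofPath_mul, APath.comp_nil_one]

theorem relation_eq_zero {ρ : QuiverRelation k Γ} (hρ : ρ ∈ I)
    (x : Quiver.Path ρ.1 ρ.2.1 → APath A ρ.1 ρ.2.1)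
    (hx : ∀ p ∈ ρ.2.2.support, IsInsertion π p (x p)) :
    (ρ.2.2.sum fun p c => c • ofPath π I (x p)) = 0 := by
  have h : mk π I (ρ.2.2.sum fun p c => c • GPathAlgebra.ofPath k (x p)) = mk π I 0 := by
    rw [mk_eq_mk_iff, sub_zero]
    exact TwoSidedIdeal.subset_span ⟨ρ, hρ, x, hx, rfl⟩
  rw [map_zero, Finsupp.sum, map_sum] at h
  rw [← h, Finsupp.sum]
  exact Finset.sum_congr rfl fun p _ => (map_smul (mk π I) _ _).symm

end GBPAlgebra

end GBP

/-! ## Representations -/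

section Rep

variable {k : Type uk} [Field k] {Γ : Type uΓ} [Quiver.{vv} Γ] {A : Γ → Type va}
  [∀ i, Ring (A i)] [∀ i, Algebra k (A i)]

/-- The linear map `M_i → M_j` defined by an `𝒜`-path from `i` to `j`: the composite of the maps of
its arrows and of the right multiplications by its entries, in the order in which they occur. -/
def APath.act {M : Γ → Type w} [∀ i, AddCommGroup (M i)] [∀ i, Module k (M i)]
    [∀ i, Module (A i)ᵐᵒᵖ (M i)] [∀ i, IsScalarTower k (A i)ᵐᵒᵖ (M i)]
    (φ : ∀ {i j : Γ}, (i ⟶ j) → (M i →ₗ[k] M j)) : ∀ {i j : Γ}, APath A i j → (M i →ₗ[k] M j)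
  | i, _, .nil a => Algebra.lsmul k k (M i) (op a)
  | _, j, .cons x β a => Algebra.lsmul k k (M j) (op a) ∘ₗ φ β ∘ₗ APath.act φ x

/-- Representations of `k(Γ,𝒜,I)`; right `A_i`-modules are modules over `(A_i)ᵐᵒᵖ`. -/
structure GRep (π : ∀ i, QuiverPresentation.{uk, va, us, vs} k (A i))
    (I : Set (QuiverRelation k Γ)) where
  obj : Γ → Type w
  [addCommGroup : ∀ i, AddCommGroup (obj i)]
  [module : ∀ i, Module k (obj i)]
  [rightModule : ∀ i, Module (A i)ᵐᵒᵖ (obj i)]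
  [isScalarTower : ∀ i, IsScalarTower k (A i)ᵐᵒᵖ (obj i)]
  map : ∀ {i j : Γ}, (i ⟶ j) → (obj i →ₗ[k] obj j)
  satisfies : ∀ ρ ∈ I, ∀ x : Quiver.Path ρ.1 ρ.2.1 → APath A ρ.1 ρ.2.1,
    (∀ p ∈ ρ.2.2.support, IsInsertion π p (x p)) →
      (ρ.2.2.sum fun p c => c • APath.act map (x p)) = 0

attribute [instance] GRep.addCommGroup GRep.module GRep.rightModule GRep.isScalarTower

namespace GRep

variable {π : ∀ i, QuiverPresentation.{uk, va, us, vs} k (A i)} {I : Set (QuiverRelation k Γ)}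

/-- Morphisms of representations. -/
@[ext] structure Hom (M : GRep.{uk, uΓ, va, vv, us, vs, w} π I)
    (N : GRep.{uk, uΓ, va, vv, us, vs, w'} π I) where
  app : ∀ i, M.obj i →ₗ[(A i)ᵐᵒᵖ] N.obj i
  comm : ∀ {i j : Γ} (β : i ⟶ j) (m : M.obj i), app j (M.map β m) = N.map β (app i m)

/-- Isomorphisms of representations. -/
structure Iso (M : GRep.{uk, uΓ, va, vv, us, vs, w} π I)
    (N : GRep.{uk, uΓ, va, vv, us, vs, w'} π I) where
  app : ∀ i, M.obj i ≃ₗ[(A i)ᵐᵒᵖ] N.obj i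
  comm : ∀ {i j : Γ} (β : i ⟶ j) (m : M.obj i), app j (M.map β m) = N.map β (app i m)

/-- The morphism underlying an isomorphism. -/
def Iso.hom {M : GRep.{uk, uΓ, va, vv, us, vs, w} π I}
    {N : GRep.{uk, uΓ, va, vv, us, vs, w'} π I} (f : Iso M N) : Hom M N where
  app i := (f.app i).toLinearMap
  comm β m := f.comm β m

/-- Composition: first `f`, then `g`. -/
def Hom.comp {M N L : GRep.{uk, uΓ, va, vv, us, vs, w} π I} (f : Hom M N) (g : Hom N L) :
    Hom M L where
  app i := g.app i ∘ₗ f.app i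
  comm β m := by simp [f.comm, g.comm]

/-- Subrepresentations: families of `A_i`-submodules stable under the maps of the arrows. -/
structure Sub (M : GRep.{uk, uΓ, va, vv, us, vs, w} π I) where
  carrier : ∀ i, Submodule (A i)ᵐᵒᵖ (M.obj i)
  stable : ∀ {i j : Γ} (β : i ⟶ j) (m : M.obj i), m ∈ carrier i → M.map β m ∈ carrier j

variable {M : GRep.{uk, uΓ, va, vv, us, vs, w} π I}

/-- The restriction of the map of an arrow to a subrepresentation. -/
def Sub.map (N : Sub M) {i j : Γ} (β : i ⟶ j) : N.carrier i →ₗ[k] N.carrier j where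
  toFun m := ⟨M.map β m, N.stable β m m.2⟩
  map_add' m n := Subtype.ext (by simp)
  map_smul' c m := Subtype.ext (by simp)

theorem Sub.coe_act (N : Sub M) {i j : Γ} (x : APath A i j) (m : N.carrier i) :
    ((APath.act (M := fun i => N.carrier i) N.map x m : N.carrier j) : M.obj j) =
      APath.act M.map x m := by
  induction x with
  | nil a => simp [APath.act]
  | cons x β a ih => simp [APath.act, Sub.map, ih]

/-- A subrepresentation as a representation, with the restricted maps. -/
def Sub.toRep (N : Sub M) : GRep.{uk, uΓ, va, vv, us, vs, w} π I where
  obj i := N.carrier i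
  map β := N.map β
  satisfies ρ hρ x hx := by
    refine LinearMap.ext fun m => Subtype.ext ?_
    have h := LinearMap.congr_fun (M.satisfies ρ hρ x hx) (m : M.obj ρ.1)
    simp only [Finsupp.sum, LinearMap.sum_apply, LinearMap.smul_apply, LinearMap.zero_apply,
      AddSubmonoidClass.coe_finsetSum, ZeroMemClass.coe_zero] at h ⊢
    rw [← h]
    refine Finset.sum_congr rfl fun p _ => ?_
    rw [← N.coe_act]
    rfl

/-- The inclusion of a subrepresentation. -/
def Sub.incl (N : Sub M) : Hom N.toRep M where
  app i := (N.carrier i).subtype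
  comm _ _ := rfl

end GRep

/-! ## The representation of a module -/

variable [Fintype Γ]
variable (π : ∀ i, QuiverPresentation.{uk, va, us, vs} k (A i)) (I : Set (QuiverRelation k Γ))

section

variable (X : Type w) [AddCommGroup X] [Module k X] [Module (GBPAlgebra π I)ᵐᵒᵖ X]
  [IsScalarTower k (GBPAlgebra π I)ᵐᵒᵖ X]

/-- The subspace `X · 1_i` of a right `Λ`-module `X`. -/
def vertexSpace (i : Γ) : Submodule k X :=
  LinearMap.range (Algebra.lsmul k k X (op (GBPAlgebra.ofVertex π I i 1)))

variable {X}

theorem vertexSpace.smul_mem {i : Γ} {y : GBPAlgebra π I}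
    (hy : y * GBPAlgebra.ofVertex π I i 1 = y) (x : X) : op y • x ∈ vertexSpace π I X i :=
  ⟨op y • x, by
    change op (GBPAlgebra.ofVertex π I i 1) • op y • x = op y • x
    rw [smul_smul, ← op_mul, hy]⟩

theorem vertexSpace.smul_one {i : Γ} {x : X} (hx : x ∈ vertexSpace π I X i) :
    op (GBPAlgebra.ofVertex π I i 1) • x = x := by
  obtain ⟨y, rfl⟩ := hx
  change op (GBPAlgebra.ofVertex π I i 1) • op (GBPAlgebra.ofVertex π I i 1) • y =
    op (GBPAlgebra.ofVertex π I i 1) • y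
  rw [smul_smul, ← op_mul, GBPAlgebra.ofVertex_mul, one_mul]

variable (X)

/-- The right `A_i`-module structure of `X · 1_i`, `x · a = x · ā`. -/
instance vertexSpace.rightModule (i : Γ) : Module (A i)ᵐᵒᵖ (vertexSpace π I X i) where
  smul a x := ⟨op (GBPAlgebra.ofVertex π I i a.unop) • (x : X),
    vertexSpace.smul_mem π I (by rw [GBPAlgebra.ofVertex_mul, mul_one]) _⟩
  one_smul x := Subtype.ext (vertexSpace.smul_one π I x.2)
  mul_smul a b x := Subtype.ext (by
    change op (GBPAlgebra.ofVertex π I i (b.unop * a.unop)) • (x : X) =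
      op (GBPAlgebra.ofVertex π I i a.unop) • op (GBPAlgebra.ofVertex π I i b.unop) • (x : X)
    rw [smul_smul, ← op_mul, GBPAlgebra.ofVertex_mul])
  smul_zero a := Subtype.ext (smul_zero _)
  smul_add a x y := Subtype.ext (smul_add _ _ _)
  add_smul a b x := Subtype.ext (by
    change op (GBPAlgebra.ofVertex π I i (a.unop + b.unop)) • (x : X) =
      op (GBPAlgebra.ofVertex π I i a.unop) • (x : X) +
        op (GBPAlgebra.ofVertex π I i b.unop) • (x : X)
    rw [GBPAlgebra.ofVertex_add, op_add, add_smul])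
  zero_smul x := Subtype.ext (by
    change op (GBPAlgebra.ofVertex π I i 0) • (x : X) = 0
    have h := GBPAlgebra.ofVertex_smul π I i (0 : k) 0
    rw [zero_smul, zero_smul] at h
    rw [h, op_zero, zero_smul])

theorem vertexSpace.coe_smul (i : Γ) (a : A i) (x : vertexSpace π I X i) :
    ((op a • x : vertexSpace π I X i) : X) = op (GBPAlgebra.ofVertex π I i a) • (x : X) := rfl

instance vertexSpace.isScalarTower (i : Γ) :
    IsScalarTower k (A i)ᵐᵒᵖ (vertexSpace π I X i) where
  smul_assoc c a x := Subtype.ext (by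
    change op (GBPAlgebra.ofVertex π I i (c • a.unop)) • (x : X) =
      c • (op (GBPAlgebra.ofVertex π I i a.unop) • (x : X))
    rw [GBPAlgebra.ofVertex_smul, op_smul, smul_assoc])

/-- The map `X · 1_i → X · 1_j`, `x ↦ x · β`, of an arrow `β : i → j`. -/
def vertexSpace.map {i j : Γ} (β : i ⟶ j) : vertexSpace π I X i →ₗ[k] vertexSpace π I X j :=
  LinearMap.codRestrict (vertexSpace π I X j)
    (Algebra.lsmul k k X (op (GBPAlgebra.ofArrow π I β)) ∘ₗ (vertexSpace π I X i).subtype)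
    (fun x => vertexSpace.smul_mem π I (GBPAlgebra.ofArrow_mul_ofVertex_one π I β) (x : X))

theorem vertexSpace.coe_act {i j : Γ} (x : APath A i j) (m : vertexSpace π I X i) :
    ((APath.act (M := fun i => vertexSpace π I X i) (vertexSpace.map π I X) x m :
      vertexSpace π I X j) : X) = op (GBPAlgebra.ofPath π I x) • (m : X) := by
  induction x with
  | nil a => rw [APath.act]; rfl
  | cons x β a ih =>
    have h := ih
    rw [GBPAlgebra.ofPath_cons, op_mul, op_mul, mul_smul, mul_smul, ← h, APath.act]
    rfl

/-- The representation associated to a right `Λ`-module `X`: the `A_i`-modules `X · 1_i` with the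
maps `x ↦ x · β`. -/
def GRep.ofModule : GRep.{uk, uΓ, va, vv, us, vs, w} π I where
  obj i := vertexSpace π I X i
  map β := vertexSpace.map π I X β
  satisfies ρ hρ x hx := by
    refine LinearMap.ext fun m => Subtype.ext ?_
    have h := GBPAlgebra.relation_eq_zero π I hρ x hx
    simp only [Finsupp.sum, LinearMap.sum_apply, LinearMap.smul_apply, LinearMap.zero_apply,
      AddSubmonoidClass.coe_finsetSum, Submodule.coe_smul, ZeroMemClass.coe_zero,
      vertexSpace.coe_act] at h ⊢
    have h' := congrArg (fun y => op y • (m : X)) h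
    simpa only [op_zero, zero_smul, Finset.op_sum, Finset.sum_smul, op_smul, smul_assoc] using h'

end

/-- The morphism of representations associated to a homomorphism of right `Λ`-modules, given by
restriction. -/
def GRep.mapModule {X Y : Type w} [AddCommGroup X] [Module k X] [Module (GBPAlgebra π I)ᵐᵒᵖ X]
    [IsScalarTower k (GBPAlgebra π I)ᵐᵒᵖ X] [AddCommGroup Y] [Module k Y]
    [Module (GBPAlgebra π I)ᵐᵒᵖ Y] [IsScalarTower k (GBPAlgebra π I)ᵐᵒᵖ Y]
    (g : X →ₗ[(GBPAlgebra π I)ᵐᵒᵖ] Y) : Hom (GRep.ofModule π I X) (GRep.ofModule π I Y) where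
  app i :=
    { toFun := fun x => (⟨g (x : vertexSpace π I X i).1, by
          rw [← vertexSpace.smul_one π I x.2, map_smul]
          exact vertexSpace.smul_mem π I (by rw [GBPAlgebra.ofVertex_mul, mul_one]) _⟩ :
            vertexSpace π I Y i)
      map_add' := fun x y => Subtype.ext (map_add g _ _)
      map_smul' := fun a x => Subtype.ext (map_smul g _ _) }
  comm β m := Subtype.ext (map_smul g _ _)

end Rep

/-! ## Idempotents and projectives -/

/-- Primitive idempotents: nonzero idempotents that are not the sum of two nonzero orthogonal
idempotents. -/
def IsPrimitiveIdempotent {R : Type*} [Ring R] (e : R) : Prop :=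
  IsIdempotentElem e ∧ e ≠ 0 ∧ ∀ f g : R, IsIdempotentElem f → IsIdempotentElem g →
    f * g = 0 → g * f = 0 → e = f + g → f = 0 ∨ g = 0

/-- The right ideal `e R`. -/
abbrev rightIdeal {R : Type*} [Ring R] (e : R) : Submodule Rᵐᵒᵖ R := Submodule.span Rᵐᵒᵖ {e}

/-- The radical of a right module: the intersection of its maximal submodules. -/
abbrev rightRad (R : Type*) [Ring R] (X : Type*) [AddCommGroup X] [Module Rᵐᵒᵖ X] :
    Submodule Rᵐᵒᵖ X := Module.jacobson Rᵐᵒᵖ X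

end

noncomputable section

open MulOpposite

/-!
Sending `ȳ` to its component at the trivial path of `i` is a ring homomorphism `τ : Λ → A_i`, since
no cycle passes through `i` and no relation involves the trivial path at `i`; it satisfies
`ā y b̄ = (a τ(y) b)‾`. Hence `x ↦ x̄` identifies `a A_i` with the component of `ā Λ` at `i`, and an
element `x` of `ā Λ` with `τ x = 0` satisfies `x Λ ā = 0` when `a` is idempotent. As `ā` generates
`ā Λ`, such an `x` cannot supplement a maximal submodule, so it lies in the radical, and
`rad (ā Λ)` is the preimage of `rad (a A_i)` under `τ`. On the component at `i` this is
`rad (a A_i)` itself; the components at the other vertices are annihilated by `τ`, so they lie in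
`rad (ā Λ)`.
-/

section RightIdeal

variable {R S : Type*} [Ring R] [Ring S]

theorem mem_rightIdeal_iff_exists {e x : R} : x ∈ rightIdeal e ↔ ∃ r, e * r = x :=
  Submodule.mem_span_singleton.trans op_surjective.exists

theorem mem_rightIdeal_iff_mul_eq {e x : R} (he : IsIdempotentElem e) :
    x ∈ rightIdeal e ↔ e * x = x := by
  refine mem_rightIdeal_iff_exists.trans ⟨?_, fun h => ⟨x, h⟩⟩
  rintro ⟨r, rfl⟩
  rw [← mul_assoc, he.eq]

theorem mem_rightRad_of_mul_mul_eq_zero {e : R} (he : IsIdempotentElem e) (x : rightIdeal e)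
    (hx : ∀ c, (x : R) * c * e = 0) : x ∈ rightRad R (rightIdeal e) := by
  refine Submodule.mem_sInf.2 fun K hK => ?_
  by_contra hxK
  let g : rightIdeal e := ⟨e, Submodule.mem_span_singleton_self e⟩
  have hsup : K ⊔ Submodule.span Rᵐᵒᵖ {x} = ⊤ :=
    hK.2 _ (left_lt_sup.2 fun h => hxK (h (Submodule.mem_span_singleton_self x)))
  obtain ⟨y, hy, z, hz, hyz⟩ := Submodule.mem_sup.1 (hsup ▸ Submodule.mem_top : g ∈ _)
  obtain ⟨c, rfl⟩ := Submodule.mem_span_singleton.1 hz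
  have hg : op e • y = g := by
    have hc : op e • c • x = 0 := Subtype.ext (hx c.unop)
    rw [← add_zero (op e • y), ← hc, ← smul_add, hyz]
    exact Subtype.ext he.eq
  refine hK.1 (eq_top_iff.2 fun w _ => ?_)
  obtain ⟨r, hr⟩ := mem_rightIdeal_iff_exists.1 w.2
  have hw : op r • op e • y = w := hg ▸ Subtype.ext hr
  exact hw ▸ K.smul_mem _ (K.smul_mem _ hy)

/-- The map `e R → f S` of right ideals to which a ring homomorphism `τ : R → S` with
`τ e = f` restricts. -/
def rightIdealMap (τ : R →+* S) {e : R} {f : S} (hef : τ e = f) :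
    rightIdeal e →ₛₗ[τ.op] rightIdeal f where
  toFun x := ⟨τ x, by
    obtain ⟨r, hr⟩ := mem_rightIdeal_iff_exists.1 x.2
    exact mem_rightIdeal_iff_exists.2 ⟨τ r, by rw [← hef, ← map_mul, hr]⟩⟩
  map_add' _ _ := Subtype.ext (map_add τ _ _)
  map_smul' _ _ := Subtype.ext (map_mul τ _ _)

theorem rightIdealMap_surjective {τ : R →+* S} (hτ : Function.Surjective τ) {e : R} {f : S}
    (hef : τ e = f) : Function.Surjective (rightIdealMap τ hef) := by
  subst hef
  rintro ⟨y, hy⟩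
  obtain ⟨s, rfl⟩ := mem_rightIdeal_iff_exists.1 hy
  obtain ⟨r, rfl⟩ := hτ s
  exact ⟨⟨e * r, mem_rightIdeal_iff_exists.2 ⟨r, rfl⟩⟩, Subtype.ext (map_mul τ e r)⟩

theorem mem_rightRad_iff_of_surjective {τ : R →+* S} (hτ : Function.Surjective τ) {e : R} {f : S}
    (hef : τ e = f) (he : IsIdempotentElem e) (hker : ∀ y, τ y = 0 → e * y * e = 0)
    (x : rightIdeal e) :
    x ∈ rightRad R (rightIdeal e) ↔ rightIdealMap τ hef x ∈ rightRad S (rightIdeal f) := by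
  have hle : LinearMap.ker (rightIdealMap τ hef) ≤ rightRad R (rightIdeal e) := by
    intro z hz
    have hτz : τ z = 0 := congrArg Subtype.val (LinearMap.mem_ker.1 hz)
    refine mem_rightRad_of_mul_mul_eq_zero he z fun c => ?_
    rw [← (mem_rightIdeal_iff_mul_eq he).1 z.2, mul_assoc e]
    exact hker _ (by rw [map_mul, hτz, zero_mul])
  have : RingHomSurjective τ.op := ⟨op_surjective.comp (hτ.comp unop_surjective)⟩
  rw [rightRad, ← Module.comap_jacobson_of_ker_le (rightIdealMap_surjective hτ hef) hle,
    Submodule.mem_comap]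

end RightIdeal

namespace CompAlg

variable {k : Type*} [Field k] {V : Type*} {H : V → V → Type*}
  [∀ i j, AddCommGroup (H i j)] [∀ i j, Module k (H i j)]

theorem of_apply_of_ne {a b i j : V} (f : H i j) (h : ¬(i = a ∧ j = b)) : of k i j f a b = 0 := by
  by_cases hi : i = a
  · subst hi
    exact of_ne_right f fun hb => h ⟨rfl, hb.symm⟩
  · exact of_ne_left f (Ne.symm hi)

variable [Fintype V] [LinComp k H]

theorem of_mul_apply {i j : V} (f : H i j) (y : CompAlg k H) (b : V) :
    (of k i j f * y) i b = LinComp.comp (k := k) f (y j b) := by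
  rw [mul_apply, Finset.sum_eq_single j, of_same]
  · intro c _ hc
    rw [of_ne_right f hc, map_zero, LinearMap.zero_apply]
  · simp

theorem of_mul_apply_of_ne {a i j : V} (f : H i j) (y : CompAlg k H) (b : V) (h : a ≠ i) :
    (of k i j f * y) a b = 0 := by
  rw [mul_apply]
  exact Finset.sum_eq_zero fun c _ => by rw [of_ne_left f h, map_zero, LinearMap.zero_apply]

theorem mul_of_apply {i j : V} (y : CompAlg k H) (g : H i j) (a : V) :
    (y * of k i j g) a j = LinComp.comp (k := k) (y a i) g := by
  rw [mul_apply, Finset.sum_eq_single i, of_same]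
  · intro c _ hc
    rw [of_ne_left g hc, map_zero]
  · simp

theorem mul_of_apply_of_ne {b i j : V} (y : CompAlg k H) (g : H i j) (a : V) (h : b ≠ j) :
    (y * of k i j g) a b = 0 := by
  rw [mul_apply]
  refine Finset.sum_eq_zero fun c _ => ?_
  rw [of_apply_of_ne g fun hb => h hb.2.symm, map_zero]

theorem of_mul_mul_of {a i j b : V} (f : H a i) (y : CompAlg k H) (g : H j b) :
    of k a i f * y * of k j b g =
      of k a b (LinComp.comp (k := k) (LinComp.comp (k := k) f (y i j)) g) := by
  ext c d
  by_cases hd : d = b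
  · subst hd
    rw [mul_of_apply]
    by_cases hc : c = a
    · subst hc
      rw [of_mul_apply, of_same]
    · rw [of_mul_apply_of_ne f y j hc, of_ne_left _ hc, map_zero, LinearMap.zero_apply]
  · rw [mul_of_apply_of_ne _ g c hd, of_apply_of_ne _ fun h => hd h.2.symm]

/-- The algebra homomorphism `f ↦ φ (f i i)` defined by a multiplicative linear map `φ` on `H i i`
that annihilates the composites through vertices other than `i`. -/
def cornerHom {B : Type*} [Ring B] [Algebra k B] {i : V} (φ : H i i →ₗ[k] B)
    (map_idn : φ (LinComp.idn (k := k) i) = 1)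
    (map_comp : ∀ f g : H i i, φ (LinComp.comp (k := k) f g) = φ f * φ g)
    (map_comp_of_ne : ∀ j, j ≠ i → ∀ (f : H i j) (g : H j i), φ (LinComp.comp (k := k) f g) = 0) :
    CompAlg k H →ₐ[k] B :=
  AlgHom.ofLinearMap
    { toFun := fun f => φ (f i i)
      map_add' := fun f g => map_add φ (f i i) (g i i)
      map_smul' := fun c f => map_smul φ c (f i i) }
    (by
      classical
      change φ ((1 : CompAlg k H) i i) = 1
      rw [one_apply, Pi.single_eq_same, map_idn])
    (fun f g => by
      change φ ((f * g) i i) = φ (f i i) * φ (g i i)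
      rw [mul_apply, map_sum, Finset.sum_eq_single i, map_comp]
      · exact fun j _ hj => map_comp_of_ne j hj _ _
      · simp)

end CompAlg

section PathAlgebra

variable (k : Type*) [Field k] {Q : Type*} [Quiver Q]

theorem PathHom.comp_apply_nil {i : Q} (f g : Quiver.Path i i →₀ k) :
    (PathHom.comp k f g : Quiver.Path i i →₀ k) .nil = f .nil * g .nil := by
  let ε : (Quiver.Path i i →₀ k) →ₗ[k] k := Finsupp.lapply .nil
  suffices h : (PathHom.comp k).compr₂ ε = (LinearMap.mul k k).compl₁₂ ε ε from
    LinearMap.congr_fun₂ h f g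
  ext p q
  cases q <;> cases p <;> simp [ε, PathHom.comp_single]

theorem PathHom.comp_apply_nil_of_ne {i j : Q} (hij : j ≠ i) (f : Quiver.Path i j →₀ k)
    (g : Quiver.Path j i →₀ k) : (PathHom.comp k f g : Quiver.Path i i →₀ k) .nil = 0 := by
  suffices h : (PathHom.comp k).compr₂ (Finsupp.lapply (.nil : Quiver.Path i i)) =
      (0 : (Quiver.Path i j →₀ k) →ₗ[k] (Quiver.Path j i →₀ k) →ₗ[k] k) from
    LinearMap.congr_fun₂ h f g
  ext p q
  cases q with
  | nil => exact absurd rfl hij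
  | cons q β => simp [PathHom.comp_single]

variable [Fintype Q]

/-- The coefficient of the trivial path at `i` in an element of `kQ`. -/
def PathAlgebra.nilCoeff (i : Q) : PathAlgebra k Q →ₐ[k] k :=
  CompAlg.cornerHom (H := PathHom k Q) (Finsupp.lapply (.nil : Quiver.Path i i))
    Finsupp.single_eq_same (PathHom.comp_apply_nil k)
    (fun _ => PathHom.comp_apply_nil_of_ne k)

theorem PathAlgebra.lengthIdeal_le_ker_nilCoeff {n : ℕ} (hn : 0 < n) (i : Q) :
    lengthIdeal k Q n ≤ TwoSidedIdeal.ker (nilCoeff k i) := by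
  refine TwoSidedIdeal.span_le.2 ?_
  rintro _ ⟨a, b, p, hp, rfl⟩
  refine (TwoSidedIdeal.mem_ker _).2 ?_
  change (CompAlg.of k (H := PathHom k Q) a b (Finsupp.single p 1) i i :
    Quiver.Path i i →₀ k) .nil = 0
  by_cases h : a = i ∧ b = i
  · obtain ⟨rfl, rfl⟩ := h
    rw [CompAlg.of_same]
    refine Finsupp.single_eq_of_ne fun hnil => ?_
    rw [← hnil, Quiver.Path.length_nil] at hp
    exact hn.not_ge hp
  · rw [CompAlg.of_apply_of_ne _ h, Finsupp.zero_apply]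

variable {k} in
theorem QuiverRelation.apply_nil_eq_zero {n : ℕ} (hn : 0 < n) {i : Q} {r : Quiver.Path i i →₀ k}
    (hr : toPathAlgebra ⟨i, i, r⟩ ∈ PathAlgebra.lengthIdeal k Q n) : r .nil = 0 := by
  have h : PathAlgebra.nilCoeff k i (toPathAlgebra ⟨i, i, r⟩) = 0 :=
    (TwoSidedIdeal.mem_ker _).1 (PathAlgebra.lengthIdeal_le_ker_nilCoeff k hn i hr)
  change (CompAlg.of k (H := PathHom k Q) i i r i i : Quiver.Path i i →₀ k) .nil = 0 at h
  rwa [CompAlg.of_same] at h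

end PathAlgebra

section APath

variable {Γ : Type uΓ} [Quiver.{vv} Γ] {A : Γ → Type va}

/-- The path `β₁ ⋯ βₙ` of `Γ` underlying the `𝒜`-path `a₁ β₁ ⋯ βₙ aₙ₊₁`. -/
def APath.toPath {i : Γ} : ∀ {j : Γ}, APath A i j → Quiver.Path i j
  | _, .nil _ => .nil
  | _, .cons x β _ => x.toPath.cons β

theorem APath.exists_eq_nil {i : Γ} (acyclic : ∀ p : Quiver.Path i i, p.length = 0)
    (x : APath A i i) : ∃ a, x = .nil a := by
  cases x with
  | nil a => exact ⟨a, rfl⟩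
  | cons x β a => exact absurd (acyclic (x.toPath.cons β)) (Nat.succ_ne_zero _)

variable [∀ i, Ring (A i)]

/-- The entry of an `𝒜`-path of length zero; zero for `𝒜`-paths of positive length. -/
def APath.nilPart {i : Γ} : ∀ {j : Γ}, APath A i j → A i
  | _, .nil a => a
  | _, .cons _ _ _ => 0

theorem APath.nilPart_comp {i : Γ} (x y : APath A i i) :
    (x.comp y).nilPart = x.nilPart * y.nilPart := by
  cases y with
  | nil b => cases x <;> simp [comp, mulLast, nilPart]
  | cons y β b => simp [comp, nilPart]

theorem APath.nilPart_comp_of_ne {i j : Γ} (hij : j ≠ i) (x : APath A i j) (y : APath A j i) :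
    (x.comp y).nilPart = 0 := by
  cases y with
  | nil b => exact absurd rfl hij
  | cons y β b => rfl

end APath

section GPathHom

variable {k : Type uk} [Field k] {Γ : Type uΓ} [Quiver.{vv} Γ] {A : Γ → Type va}
  [∀ i, Ring (A i)] [∀ i, Algebra k (A i)]

namespace GPathHom

theorem linearMap_ext {B : Type*} [AddCommGroup B] [Module k B] {i j : Γ}
    {F G : GPathHom k A i j →ₗ[k] B} (h : ∀ x, F (mk k x) = G (mk k x)) : F = G :=
  Submodule.linearMap_qext _ (Finsupp.lhom_ext' fun x => LinearMap.ext_ring (h x))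

theorem linearMap_ext₂ {B : Type*} [AddCommGroup B] [Module k B] {i j i' j' : Γ}
    {F G : GPathHom k A i j →ₗ[k] GPathHom k A i' j' →ₗ[k] B}
    (h : ∀ x y, F (mk k x) (mk k y) = G (mk k x) (mk k y)) : F = G :=
  linearMap_ext fun x => linearMap_ext fun y => h x y

/-- The linear extension of `APath.nilPart`, which projects onto the part of length zero. -/
def nilPart (i j : Γ) : GPathHom k A i j →ₗ[k] A i :=
  Submodule.liftQ (APath.multilinRel k A i j)
    (Finsupp.linearCombination k APath.nilPart)
    (by
      refine Submodule.span_le.2 ?_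
      rintro _ (⟨v, f, a, b, hf, rfl⟩ | ⟨v, f, c, a, hf, rfl⟩) <;>
      cases hf <;> simp [APath.nilPart])

theorem nilPart_mk {i j : Γ} (x : APath A i j) : nilPart i j (mk k x) = x.nilPart := by
  change Finsupp.linearCombination k APath.nilPart (Finsupp.single x 1) = _
  rw [Finsupp.linearCombination_single, one_smul]

theorem nilPart_comp {i : Γ} (f g : GPathHom k A i i) :
    nilPart i i (comp k f g) = nilPart i i f * nilPart i i g := by
  suffices h : (comp k).compr₂ (nilPart (A := A) i i) =
      (LinearMap.mul k (A i)).compl₁₂ (nilPart i i) (nilPart i i) from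
    LinearMap.congr_fun₂ h f g
  refine linearMap_ext₂ fun x y => ?_
  simp only [LinearMap.compr₂_apply, LinearMap.compl₁₂_apply, LinearMap.mul_apply', comp_mk,
    nilPart_mk, APath.nilPart_comp]

theorem nilPart_comp_of_ne {i j : Γ} (hij : j ≠ i) (f : GPathHom k A i j)
    (g : GPathHom k A j i) : nilPart i i (comp k f g) = 0 := by
  suffices h : (comp k).compr₂ (nilPart (A := A) i i) =
      (0 : GPathHom k A i j →ₗ[k] GPathHom k A j i →ₗ[k] A i) from
    LinearMap.congr_fun₂ h f g
  refine linearMap_ext₂ fun x y => ?_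
  simp only [LinearMap.compr₂_apply, comp_mk, nilPart_mk, APath.nilPart_comp_of_ne hij,
    LinearMap.zero_apply]

theorem exists_eq_mk_nil {i : Γ} (acyclic : ∀ p : Quiver.Path i i, p.length = 0)
    (f : GPathHom k A i i) : ∃ a, f = mk k (.nil a) := by
  induction f using GPathHom.induction k with
  | zero => exact ⟨0, by simpa using (mk_slot_smul k (.nil (A := A) (i := i)) 0 0).symm⟩
  | add f g hf hg =>
    obtain ⟨a, rfl⟩ := hf
    obtain ⟨b, rfl⟩ := hg
    exact ⟨a + b, (mk_slot_add k .nil a b).symm⟩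
  | smul_mk c x =>
    obtain ⟨a, rfl⟩ := x.exists_eq_nil acyclic
    exact ⟨c • a, (mk_slot_smul k .nil c a).symm⟩

end GPathHom

namespace GPathAlgebra

variable [Fintype Γ]

variable (k) in
/-- The algebra homomorphism `k(Γ,𝒜) → A_i` that annihilates the `𝒜`-paths other than those of
length zero at `i`. -/
def toVertex (i : Γ) : GPathAlgebra k A →ₐ[k] A i :=
  CompAlg.cornerHom (GPathHom.nilPart i i) (GPathHom.nilPart_mk _) GPathHom.nilPart_comp
    (fun _ => GPathHom.nilPart_comp_of_ne)

theorem toVertex_ofPath_nil {i : Γ} (a : A i) : toVertex k i (ofPath k (.nil a)) = a := by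
  change GPathHom.nilPart i i (CompAlg.of k i i (GPathHom.mk k (.nil a)) i i) = a
  rw [CompAlg.of_same, GPathHom.nilPart_mk, APath.nilPart]

theorem toVertex_ofPath_nil_of_ne {i l : Γ} (h : l ≠ i) (a : A l) :
    toVertex k i (ofPath k (.nil a)) = 0 := by
  change GPathHom.nilPart i i (CompAlg.of k l l (GPathHom.mk k (.nil a)) i i) = 0
  rw [CompAlg.of_apply_of_ne _ fun hl => h hl.1, map_zero]

theorem toVertex_ofPath_cons {i j l m : Γ} (x : APath A j l) (β : l ⟶ m) (a : A m) :
    toVertex k i (ofPath k (.cons x β a)) = 0 := by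
  change GPathHom.nilPart i i (CompAlg.of k j m (GPathHom.mk k (.cons x β a)) i i) = 0
  by_cases h : j = i ∧ m = i
  · obtain ⟨rfl, rfl⟩ := h
    rw [CompAlg.of_same, GPathHom.nilPart_mk, APath.nilPart]
  · rw [CompAlg.of_apply_of_ne _ h, map_zero]

theorem ofPath_nil_mul_mul_ofPath_nil {i : Γ} (acyclic : ∀ p : Quiver.Path i i, p.length = 0)
    (a b : A i) (f : GPathAlgebra k A) :
    ofPath k (.nil a) * f * ofPath k (.nil b) = ofPath k (.nil (a * toVertex k i f * b)) := by
  obtain ⟨c, hc⟩ := GPathHom.exists_eq_mk_nil acyclic (f i i)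
  have hfc : toVertex k i f = c :=
    (congrArg (GPathHom.nilPart i i) hc).trans (GPathHom.nilPart_mk _)
  refine (CompAlg.of_mul_mul_of (k := k) (H := GPathHom k A) _ f _).trans ?_
  change of k i i (GPathHom.comp k (GPathHom.comp k _ (f i i)) _) = _
  rw [hc, hfc, GPathHom.comp_mk, GPathHom.comp_mk]
  rfl

end GPathAlgebra

end GPathHom

section GBPAlgebra

variable {k : Type uk} [Field k] {Γ : Type uΓ} [Quiver.{vv} Γ] [Fintype Γ] {A : Γ → Type va}
  [∀ i, Ring (A i)] [∀ i, Algebra k (A i)]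
  {π : ∀ i, QuiverPresentation.{uk, va, us, vs} k (A i)} {I : Set (QuiverRelation k Γ)}

theorem mem_vertexSpace_iff {X : Type w} [AddCommGroup X] [Module k X]
    [Module (GBPAlgebra π I)ᵐᵒᵖ X] [IsScalarTower k (GBPAlgebra π I)ᵐᵒᵖ X] {i : Γ} {x : X} :
    x ∈ vertexSpace π I X i ↔ op (GBPAlgebra.ofVertex π I i 1) • x = x :=
  ⟨vertexSpace.smul_one π I, fun h => ⟨x, h⟩⟩

namespace GBPAlgebra

theorem ofVertex_zero (i : Γ) : ofVertex π I i 0 = 0 := by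
  simpa using ofVertex_smul π I i (0 : k) 0

theorem isIdempotentElem_ofVertex {i : Γ} {a : A i} (ha : IsIdempotentElem a) :
    IsIdempotentElem (ofVertex π I i a) := by
  rw [IsIdempotentElem, ofVertex_mul, ha.eq]

/-- The homomorphism `x ↦ x̄` of `A_i`-modules from `a A_i` to the component of `ā Λ` at `i`. -/
def rightIdealToVertexSpace {i : Γ} (a : A i) :
    rightIdeal a →ₗ[(A i)ᵐᵒᵖ] vertexSpace π I (rightIdeal (ofVertex π I i a)) i where
  toFun x := ⟨⟨ofVertex π I i x, by
      obtain ⟨b, hb⟩ := mem_rightIdeal_iff_exists.1 x.2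
      exact mem_rightIdeal_iff_exists.2 ⟨ofVertex π I i b, by rw [ofVertex_mul, hb]⟩⟩,
    mem_vertexSpace_iff.2 (Subtype.ext ((ofVertex_mul π I i _ 1).trans (by rw [mul_one])))⟩
  map_add' _ _ := Subtype.ext (Subtype.ext (ofVertex_add π I i _ _))
  map_smul' _ _ := Subtype.ext (Subtype.ext (ofVertex_mul π I i _ _).symm)

section ToVertex

variable {i : Γ} (hI : ∀ r : Quiver.Path i i →₀ k, ⟨i, i, r⟩ ∈ I → r .nil = 0)

include hI in
theorem span_insertedRelations_le_ker_toVertex :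
    TwoSidedIdeal.span (insertedRelations π I) ≤
      TwoSidedIdeal.ker (GPathAlgebra.toVertex k (A := A) i) := by
  refine TwoSidedIdeal.span_le.2 ?_
  rintro _ ⟨⟨j, l, r⟩, hr, x, hx, rfl⟩
  refine (TwoSidedIdeal.mem_ker _).2 ?_
  rw [Finsupp.sum, map_sum]
  refine Finset.sum_eq_zero fun p hp => ?_
  have hxp : IsInsertion π p (x p) := hx p hp
  rw [map_smul]
  generalize x p = y at hxp
  cases hxp with
  | cons _ β => rw [GPathAlgebra.toVertex_ofPath_cons, smul_zero]
  | nil =>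
    by_cases hj : j = i
    · subst hj
      rw [hI r hr, zero_smul]
    · rw [GPathAlgebra.toVertex_ofPath_nil_of_ne hj, smul_zero]

variable (π) in
/-- The homomorphism `Λ → A_i` that annihilates the classes of the `𝒜`-paths other than those of
length zero at `i`. -/
def toVertex : GBPAlgebra π I →+* A i :=
  RingCon.lift _ (GPathAlgebra.toVertex k (A := A) i).toRingHom fun x y hxy => by
    have h := (TwoSidedIdeal.mem_ker _).1
      (span_insertedRelations_le_ker_toVertex hI ((TwoSidedIdeal.rel_iff _ _ _).1 hxy))
    exact sub_eq_zero.1 ((map_sub _ x y).symm.trans h)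

theorem toVertex_ofVertex (a : A i) : toVertex π hI (ofVertex π I i a) = a :=
  GPathAlgebra.toVertex_ofPath_nil a

theorem toVertex_ofVertex_of_ne {l : Γ} (h : l ≠ i) (a : A l) :
    toVertex π hI (ofVertex π I l a) = 0 :=
  GPathAlgebra.toVertex_ofPath_nil_of_ne h a

theorem toVertex_surjective : Function.Surjective (toVertex π hI) :=
  fun a => ⟨_, toVertex_ofVertex hI a⟩

theorem toVertex_eq_zero_of_mem_vertexSpace {a : A i} {l : Γ} (h : l ≠ i)
    {x : rightIdeal (ofVertex π I i a)}
    (hx : x ∈ vertexSpace π I (rightIdeal (ofVertex π I i a)) l) :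
    toVertex π hI x = 0 := by
  have hxl : (x : GBPAlgebra π I) * ofVertex π I l 1 = x :=
    congrArg Subtype.val (mem_vertexSpace_iff.1 hx)
  rw [← hxl, map_mul, toVertex_ofVertex_of_ne hI h, mul_zero]

variable (acyclic : ∀ p : Quiver.Path i i, p.length = 0)

include acyclic

theorem ofVertex_mul_mul_ofVertex (a b : A i) (y : GBPAlgebra π I) :
    ofVertex π I i a * y * ofVertex π I i b = ofVertex π I i (a * toVertex π hI y * b) := by
  obtain ⟨f, rfl⟩ := mk_surjective π I y
  change mk π I _ * mk π I f * mk π I _ = mk π I _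
  rw [← map_mul, ← map_mul, GPathAlgebra.ofPath_nil_mul_mul_ofPath_nil acyclic]
  rfl

include hI in
theorem rightIdealToVertexSpace_bijective {a : A i} (ha : IsIdempotentElem a) :
    Function.Bijective (rightIdealToVertexSpace (π := π) (I := I) a) := by
  refine ⟨fun x y hxy => Subtype.ext ?_, fun y => ?_⟩
  · have h : ofVertex π I i (x : A i) = ofVertex π I i y := congrArg (fun z => z.1.1) hxy
    rw [← toVertex_ofVertex (π := π) hI (x : A i), h, toVertex_ofVertex]
  · have hy : (y.1 : GBPAlgebra π I) * ofVertex π I i 1 = y.1 :=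
      congrArg Subtype.val (mem_vertexSpace_iff.1 y.2)
    refine ⟨⟨a * toVertex π hI y.1, mem_rightIdeal_iff_exists.2 ⟨_, rfl⟩⟩,
      Subtype.ext (Subtype.ext ?_)⟩
    calc ofVertex π I i (a * toVertex π hI y.1)
        = ofVertex π I i a * y.1 * ofVertex π I i 1 := by
          rw [ofVertex_mul_mul_ofVertex hI acyclic, mul_one]
      _ = y.1 := by
          rw [(mem_rightIdeal_iff_mul_eq (isIdempotentElem_ofVertex ha)).1 y.1.2, hy]

theorem mem_rightRad_iff {a : A i} (ha : IsIdempotentElem a)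
    (x : rightIdeal (ofVertex π I i a)) :
    x ∈ rightRad (GBPAlgebra π I) (rightIdeal (ofVertex π I i a)) ↔
      rightIdealMap (toVertex π hI) (toVertex_ofVertex hI a) x ∈
        rightRad (A i) (rightIdeal a) :=
  mem_rightRad_iff_of_surjective (toVertex_surjective hI) _ (isIdempotentElem_ofVertex ha)
    (fun y hy => by
      rw [ofVertex_mul_mul_ofVertex hI acyclic, hy, mul_zero, zero_mul, ofVertex_zero]) x

end ToVertex

end GBPAlgebra

namespace GRep

variable {X : Type w} [AddCommGroup X] [Module k X] [Module (GBPAlgebra π I)ᵐᵒᵖ X]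
  [IsScalarTower k (GBPAlgebra π I)ᵐᵒᵖ X]

/-- The subrepresentation `(Y ∩ X · 1_l)_l` of the representation of `X` given by a submodule `Y`
of `X`. -/
def Sub.ofSubmodule (Y : Submodule (GBPAlgebra π I)ᵐᵒᵖ X) : Sub (GRep.ofModule π I X) where
  carrier l :=
    { carrier := {x | (x : vertexSpace π I X l).1 ∈ Y}
      add_mem' := Y.add_mem
      zero_mem' := Y.zero_mem
      smul_mem' := fun _ _ hx => Y.smul_mem _ hx }
  stable _ _ hm := Y.smul_mem _ hm

/-- The canonical isomorphism from the representation of a submodule `Y` of `X` onto the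
subrepresentation given by `Y`. -/
def Iso.ofSubmodule (Y : Submodule (GBPAlgebra π I)ᵐᵒᵖ X) :
    Iso (GRep.ofModule π I Y) (Sub.ofSubmodule Y).toRep where
  app l :=
    { toFun := fun x => ⟨(mapModule π I Y.subtype).app l x, (x : vertexSpace π I Y l).1.2⟩
      map_add' := fun _ _ => rfl
      map_smul' := fun _ _ => rfl
      invFun := fun y => ⟨⟨y.1.1, y.2⟩,
        mem_vertexSpace_iff.2 (Subtype.ext (vertexSpace.smul_one π I y.1.2))⟩
      left_inv := fun _ => rfl
      right_inv := fun _ => rfl }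
  comm _ _ := rfl

theorem Iso.ofSubmodule_hom_comp_incl (Y : Submodule (GBPAlgebra π I)ᵐᵒᵖ X) :
    (Iso.ofSubmodule Y).hom.comp (Sub.ofSubmodule Y).incl = mapModule π I Y.subtype :=
  rfl

end GRep

end GBPAlgebra

end

theorem proposition5p6_general {k : Type uk} [Field k]
    {Γ : Type uΓ} [Quiver.{vv} Γ] [Fintype Γ]
    {A : Γ → Type va} [∀ i, Ring (A i)] [∀ i, Algebra k (A i)]
    (π : ∀ i, QuiverPresentation.{uk, va, us, vs} k (A i))
    (I : Set (QuiverRelation k Γ)) (i : Γ)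
    (acyclic : ∀ p : Quiver.Path i i, p.length = 0)
    (hI : ∀ r : Quiver.Path i i →₀ k, ⟨i, i, r⟩ ∈ I → r .nil = 0)
    {a : A i} (ha : IsIdempotentElem a) :
    let Λ := GBPAlgebra π I
    let P := rightIdeal (GBPAlgebra.ofVertex π I i a)
    let M := GRep.ofModule π I P
    ∃ ι : rightIdeal a ≃ₗ[(A i)ᵐᵒᵖ] vertexSpace π I P i,
      (∀ x : rightIdeal a, ((ι x : P) : Λ) = GBPAlgebra.ofVertex π I i (x : A i)) ∧
      ∃ N : GRep.Sub M,
        N.carrier i = (rightRad (A i) (rightIdeal a)).map ι.toLinearMap ∧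
        (∀ l, l ≠ i → N.carrier l = ⊤) ∧
        ∃ f : GRep.Iso (GRep.ofModule π I (rightRad Λ P)) N.toRep,
          f.hom.comp N.incl = GRep.mapModule π I (rightRad Λ P).subtype := by
  intro Λ P M
  let ι := LinearEquiv.ofBijective _
    (GBPAlgebra.rightIdealToVertexSpace_bijective (π := π) hI acyclic ha)
  have mem_rad := GBPAlgebra.mem_rightRad_iff (π := π) hI acyclic ha
  refine ⟨ι, fun _ => rfl, .ofSubmodule (rightRad Λ P), ?_, fun l hl => ?_,
    .ofSubmodule (rightRad Λ P), GRep.Iso.ofSubmodule_hom_comp_incl _⟩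
  · ext y
    obtain ⟨x, rfl⟩ := ι.surjective y
    have hx : rightIdealMap (GBPAlgebra.toVertex π hI) (GBPAlgebra.toVertex_ofVertex hI a)
        (ι x).1 = x := Subtype.ext (GBPAlgebra.toVertex_ofVertex hI _)
    refine (mem_rad _).trans ?_
    rw [hx]
    exact ι.injective.mem_set_image.symm
  · refine eq_top_iff.2 fun y _ => (mem_rad _).2 ?_
    convert Submodule.zero_mem _
    exact Subtype.ext (GBPAlgebra.toVertex_eq_zero_of_mem_vertexSpace hI hl y.2)

theorem proposition5p6 {k : Type uk} [Field k] [IsAlgClosed k]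
    {Γ : Type uΓ} [Quiver.{vv} Γ] [Fintype Γ] [∀ i j : Γ, Finite (i ⟶ j)]
    (acyclic : ∀ (i : Γ) (p : Quiver.Path i i), p.length = 0)
    {A : Γ → Type va} [∀ i, Ring (A i)] [∀ i, Algebra k (A i)]
    (π : ∀ i, QuiverPresentation.{uk, va, us, vs} k (A i))
    (I : Set (QuiverRelation k Γ))
    (admissible : PathAlgebra.IsAdmissible
      (TwoSidedIdeal.span (QuiverRelation.toPathAlgebra '' I)))
    (s : Γ → ℕ) (e : ∀ i, Fin (s i) → A i)
    (complete : ∀ i, CompleteOrthogonalIdempotents (e i))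
    (primitive : ∀ i j, IsPrimitiveIdempotent (e i j))
    (i : Γ) (j : Fin (s i)) :
    let Λ := GBPAlgebra π I
    let Pij := rightIdeal (e i j)
    let P := rightIdeal (GBPAlgebra.ofVertex π I i (e i j))
    let M := GRep.ofModule π I P
    ∃ ι : Pij ≃ₗ[(A i)ᵐᵒᵖ] vertexSpace π I P i,
      (∀ x : Pij, ((ι x : P) : Λ) = GBPAlgebra.ofVertex π I i (x : A i)) ∧
      ∃ N : GRep.Sub M,
        N.carrier i = (rightRad (A i) Pij).map ι.toLinearMap ∧
        (∀ l, l ≠ i → N.carrier l = ⊤) ∧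
        ∃ f : GRep.Iso (GRep.ofModule π I (rightRad Λ P)) N.toRep,
          f.hom.comp N.incl = GRep.mapModule π I (rightRad Λ P).subtype :=
  proposition5p6_general π I i (acyclic i)
    (fun _ hr => QuiverRelation.apply_nil_eq_zero two_pos
      (admissible.1 (TwoSidedIdeal.subset_span ⟨_, hr, rfl⟩)))
    ((complete i).idem j)
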